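/- For $n\in\mathbb N$ let $[n]=\{1,\dots,n\}$. For a permutation $\sigma$ of $[n]$ let $P_\sigma$ be its $n\times n$ permutation matrix, with $P_\sigma(i,j)=1$ if $\sigma(i)=j$ and $0$ otherwise, and let $P^{[2]}_\sigma\in\mathbb R^{n^2\times n^2}$ be the matrix with entries $P^{[2]}_\sigma(ij,kl)=P_\sigma(i,j)\,P_\sigma(k,l)$. The QAP polytope is $\mathrm{QAP}_n=\operatorname{conv}\{P^{[2]}_\sigma : \sigma\in S_n\}\subset\mathbb R^{n^2\times n^2}$. The Jünger–Kaibel (QAP2) inequalities are, for all $P,Q\subset[n]$ and $\beta\in\mathbb N$ with $\beta+1\le |P|,|Q|\le n-3$, $|P|+|Q|\le n-3+\beta$ and $\beta\ge 2$, the inequalities in the variable $Y\in\mathbb R^{n^2\times n^2}$ $$(\beta-1)\sum_{(i,j)\in P\times Q}Y_{ij,ij}\;-\sum_{\substack{(i,j),(k,l)\in P\times Q\\ i<k}}Y_{ij,kl}\;\le\;\frac{\beta^2-\beta}{2}.$$ A polytope is the bounded solution set of a finite system of linear inequalities. A polytope $K\subset\mathbb R^{d+r}$ (with $r\ge 0$)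 is an extended formulation of a polytope $R\subset\mathbb R^d$ if $R=\{x\in\mathbb R^d : \exists\, y\in\mathbb R^r,\ (x,y)\in K\}$. The extension complexity $\mathrm{xc}(R)$ is the minimum number of facets of an extended formulation of $R$. Theorem. There are a constant $c>0$ and an integer $n_0$ such that for every $n\ge n_0$ and every polytope $R\subset\mathbb R^{n^2\times n^2}$ with $\mathrm{QAP}_n\subseteq R$ for which all the QAP2 inequalities are valid (that is, satisfied by every point of $R$), $$\mathrm{xc}(R)\ \ge\ 2^{c n}.$$ In other words, every bounded relaxation of $\mathrm{QAP}_n$ for which the QAP2 inequalities are valid has extension complexity $2^{\Omega(n)}$, uniformly over all such relaxations. -/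

import Mathlib

namespace QAPExt

/-! ### Polytopes, facets, extended formulations -/

/-- A polytope in `ℝ^ι`: the bounded solution set of a finite system `A x ≤ b` of linear
inequalities. -/
def IsPolytope {ι : Type} [Fintype ι] (P : Set (ι → ℝ)) : Prop :=
  (∃ (m : ℕ) (A : Matrix (Fin m) ι ℝ) (b : Fin m → ℝ),
      P = {x | ∀ i : Fin m, (A.mulVec x) i ≤ b i}) ∧
    Bornology.IsBounded P

/-- The dimension of a nonempty set in `ℝ^ι`, that is, the dimension of its affine hull. -/
noncomputable def affDim {ι : Type} (P : Set (ι → ℝ)) : ℕ :=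
  Module.finrank ℝ (vectorSpan ℝ P)

/-- `F` is a face of `P`: the set of points of `P` at which some inequality `a · x ≤ b`, valid on
`P`, holds with equality. -/
def IsFace {ι : Type} [Fintype ι] (P F : Set (ι → ℝ)) : Prop :=
  ∃ (a : ι → ℝ) (b : ℝ), (∀ x ∈ P, dotProduct a x ≤ b) ∧ F = {x | x ∈ P ∧ dotProduct a x = b}

/-- `F` is a facet of `P`: a (nonempty) face whose dimension is one less than that of `P`. -/
def IsFacet {ι : Type} [Fintype ι] (P F : Set (ι → ℝ)) : Prop :=
  IsFace P F ∧ F.Nonempty ∧ affDim F + 1 = affDim P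

/-- The size of a polytope: its number of facets. -/
noncomputable def size {ι : Type} [Fintype ι] (P : Set (ι → ℝ)) : ℕ∞ :=
  {F | IsFacet P F}.encard

/-- The polytope `Q ⊆ ℝ^(ι + r)` is an extended formulation of `P ⊆ ℝ^ι`:
`P = {x | ∃ y ∈ ℝ^r, (x, y) ∈ Q}`. -/
def IsExtension {ι : Type} [Fintype ι] (P : Set (ι → ℝ)) (r : ℕ) (Q : Set (ι ⊕ Fin r → ℝ)) :
    Prop :=
  IsPolytope Q ∧ P = {x | ∃ y : Fin r → ℝ, Sum.elim x y ∈ Q}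

/-- The extension complexity: the least size of an extended formulation. -/
noncomputable def extensionComplexity {ι : Type} [Fintype ι] (P : Set (ι → ℝ)) : ℕ∞ :=
  sInf {s | ∃ (r : ℕ) (Q : Set (ι ⊕ Fin r → ℝ)), IsExtension P r Q ∧ s = size Q}

/-! ### The QAP polytope and the Jünger–Kaibel inequalities -/

/-- Index set of the entries `Y ((i, j), (k, l))` of a real `n² × n²` matrix `Y`. -/
abbrev QAPIndex (n : ℕ) : Type := (Fin n × Fin n) × (Fin n × Fin n)

/-- Entry `(i, j)` of the permutation matrix of `σ`: it is `1` if `σ i = j` and `0` otherwise. -/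
def permEntry {n : ℕ} (σ : Equiv.Perm (Fin n)) (i j : Fin n) : ℝ := if σ i = j then 1 else 0

/-- The matrix `y yᵀ`, where `y` is the vectorization of the permutation matrix of `σ`. -/
def qapVertex {n : ℕ} (σ : Equiv.Perm (Fin n)) : QAPIndex n → ℝ :=
  fun p => permEntry σ p.1.1 p.1.2 * permEntry σ p.2.1 p.2.2

/-- The QAP polytope: the convex hull of the matrices `y yᵀ`. -/
def qapPolytope (n : ℕ) : Set (QAPIndex n → ℝ) :=
  convexHull ℝ (Set.range (qapVertex (n := n)))

/-- The admissible parameters: `β + 1 ≤ |P|, |Q| ≤ n - 3`, `|P| + |Q| ≤ n - 3 + β`, `β ≥ 2`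
(written without subtraction of natural numbers). -/
def QAP2Admissible {n : ℕ} (P Q : Finset (Fin n)) (β : ℕ) : Prop :=
  (β + 1 ≤ P.card ∧ P.card + 3 ≤ n) ∧ (β + 1 ≤ Q.card ∧ Q.card + 3 ≤ n) ∧
    P.card + Q.card + 3 ≤ n + β ∧ 2 ≤ β

/-- The inequality
`(β - 1) ∑_{(i,j) ∈ P × Q} Y_{ij,ij} - ∑_{(i,j), (k,l) ∈ P × Q, i < k} Y_{ij,kl} ≤ (β² - β) / 2`. -/
def QAP2Inequality {n : ℕ} (P Q : Finset (Fin n)) (β : ℕ) (Y : QAPIndex n → ℝ) : Prop :=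
  ((β : ℝ) - 1) * (∑ p ∈ P ×ˢ Q, Y (p, p))
      - (∑ p ∈ P ×ˢ Q, ∑ q ∈ P ×ˢ Q, if p.1 < q.1 then Y (p, q) else 0)
    ≤ ((β : ℝ) ^ 2 - (β : ℝ)) / 2

/-- All the Jünger–Kaibel inequalities are valid for `R`. -/
def QAP2Valid {n : ℕ} (R : Set (QAPIndex n → ℝ)) : Prop :=
  ∀ (P Q : Finset (Fin n)) (β : ℕ), QAP2Admissible P Q β → ∀ Y ∈ R, QAP2Inequality P Q β Y

end QAPExt

namespace QAPExt

/-! ### Polytopes are convex hulls of finite sets -/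

section Faces

variable {ι : Type} [Fintype ι]

/-! The inequalities with `β = 2` already force the bound. If a permutation sends `k ≤ 1` elements
of `P` into `Q`, its slack is `1 - k`. Taking `P = Q` built from a set `a`, and an involution built
from a set `b`, makes `k = |a ∩ b|` for `a, b ⊆ {0, …, m - 1}`: part of a unique-disjointness
matrix, with `m` about `n / 2`.

Let `K` be an extension. The inequality of `a` cuts out a nonempty face of `K`, and the lifted
vertex of `b` lies off it when `a`, `b` are disjoint, on it when they meet in one element. By
`exists_facet_separating` some facet contains the face and misses the point in the disjoint case,
which is impossible in the other. So the facets give rectangles covering all `3 ^ m` disjoint pairs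
and containing no pair that meets exactly once. Each holds at most `2 ^ m` disjoint pairs
(`disjointPairs_le`), so `K` has at least `(3 / 2) ^ m` facets. -/

/-- An extreme point of a polyhedron is determined by its active constraints. -/
theorem extremePoints_eq_of_active_iff {m : ℕ} (A : Matrix (Fin m) ι ℝ) (b : Fin m → ℝ)
    {x y : ι → ℝ} (hx : x ∈ Set.extremePoints ℝ {x | ∀ i : Fin m, (A.mulVec x) i ≤ b i})
    (hy : ∀ i, (A.mulVec y) i ≤ b i)
    (h : ∀ i, (A.mulVec x) i = b i → (A.mulVec y) i = b i) : x = y := by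
  have hx' : ∀ i, (A.mulVec x) i ≤ b i := hx.1
  -- Moving from `x` away from `y` keeps active constraints tight, since they are tight at `y` too;
  -- inactive ones have room for a small step.
  have hε : ∃ ε : ℝ, 0 < ε ∧ ∀ i, (A.mulVec x) i + ε * ((A.mulVec x) i - (A.mulVec y) i) ≤ b i := by
    have hev : ∀ᶠ ε : ℝ in nhdsWithin 0 (Set.Ioi 0),
        ∀ i, (A.mulVec x) i + ε * ((A.mulVec x) i - (A.mulVec y) i) ≤ b i := by
      rw [Filter.eventually_all]
      intro i
      rcases (hx' i).lt_or_eq with hi | hi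
      · have hc : Continuous fun ε : ℝ =>
            (A.mulVec x) i + ε * ((A.mulVec x) i - (A.mulVec y) i) := by fun_prop
        have := hc.tendsto 0
        simp only [zero_mul, add_zero] at this
        exact ((this.eventually_lt_const hi).filter_mono nhdsWithin_le_nhds).mono
          fun _ h => h.le
      · rw [h i hi, hi]
        simp
    obtain ⟨ε, h1, h2⟩ := (hev.and self_mem_nhdsWithin).exists
    exact ⟨ε, h2, h1⟩
  obtain ⟨ε, hε, hact⟩ := hε
  have hz : x + ε • (x - y) ∈ {x | ∀ i : Fin m, (A.mulVec x) i ≤ b i} := by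
    intro i
    have := hact i
    simpa [Matrix.mulVec_add, Matrix.mulVec_smul, Matrix.mulVec_sub] using this
  have hmem : x ∈ openSegment ℝ y (x + ε • (x - y)) := by
    refine ⟨ε / (1 + ε), 1 / (1 + ε), by positivity, by positivity, by field_simp; ring, ?_⟩
    ext i
    simp only [Pi.add_apply, Pi.smul_apply, Pi.sub_apply, smul_eq_mul]
    field_simp
    ring
  exact (hx.2 hy hz hmem).symm

theorem IsPolytope.exists_finite_convexHull {K : Set (ι → ℝ)} (hK : IsPolytope K) :
    ∃ V : Set (ι → ℝ), V.Finite ∧ K = convexHull ℝ V := by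
  obtain ⟨⟨m, A, b, rfl⟩, hb⟩ := hK
  set K := {x | ∀ i : Fin m, (A.mulVec x) i ≤ b i} with hKdef
  have hclosed : IsClosed K := by
    rw [hKdef, Set.ofPred_forall]
    refine isClosed_iInter fun i => isClosed_le ?_ continuous_const
    simp only [Matrix.mulVec, dotProduct]
    fun_prop
  have hconv : Convex ℝ K := by
    intro x hx y hy s t hs ht hst i
    have h1 := mul_le_mul_of_nonneg_left (hx i) hs
    have h2 := mul_le_mul_of_nonneg_left (hy i) ht
    have h3 : s * b i + t * b i = b i := by rw [← add_mul, hst, one_mul]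
    simp only [Matrix.mulVec_add, Matrix.mulVec_smul, Pi.add_apply, Pi.smul_apply, smul_eq_mul]
    linarith
  have hcomp : IsCompact K := Metric.isCompact_of_isClosed_isBounded hclosed hb
  have hfin : (K.extremePoints ℝ).Finite := by
    refine Set.Finite.of_finite_image (f := fun x => {i | (A.mulVec x) i = b i})
      (Set.toFinite _) ?_
    intro x hx y hy hxy
    refine extremePoints_eq_of_active_iff A b hx hy.1 fun i hi => ?_
    have : i ∈ {i | (A.mulVec x) i = b i} := hi
    rw [show {i | (A.mulVec x) i = b i} = {i | (A.mulVec y) i = b i} from hxy] at this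
    exact this
  refine ⟨K.extremePoints ℝ, hfin, ?_⟩
  rw [← (hfin.isClosed_convexHull ℝ).closure_eq]
  exact (closure_convexHull_extremePoints hcomp hconv).symm

/-! ### Every face is an intersection of facets -/

theorem affDim_mono {F G : Set (ι → ℝ)} (h : F ⊆ G) : affDim F ≤ affDim G :=
  Submodule.finrank_mono (vectorSpan_mono ℝ h)

/-- A set on which a functional is constant has smaller dimension than a larger set on which it
is not. -/
theorem affDim_lt_of_dotProduct_ne {F G : Set (ι → ℝ)} {a : ι → ℝ} {b : ℝ} (h : F ⊆ G)
    (hne : F.Nonempty) (hF : ∀ x ∈ F, dotProduct a x = b) {y : ι → ℝ} (hy : y ∈ G)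
    (hyb : dotProduct a y ≠ b) : affDim F < affDim G := by
  obtain ⟨x, hx⟩ := hne
  have hker : vectorSpan ℝ F ≤ LinearMap.ker (dotProductBilin ℝ ℝ a) := by
    rw [vectorSpan_def, Submodule.span_le]
    rintro _ ⟨u, hu, v, hv, rfl⟩
    simp [hF u hu, hF v hv, dotProduct_sub]
  refine Submodule.finrank_lt_finrank_of_lt (lt_of_le_of_ne (vectorSpan_mono ℝ h) fun heq => ?_)
  have hmem : y - x ∈ vectorSpan ℝ F := heq ▸ vsub_mem_vectorSpan ℝ hy (h hx)
  have := hker hmem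
  simp [dotProduct_sub, hF x hx, sub_eq_zero, hyb] at this

theorem exists_dotProduct_eq (φ : (ι → ℝ) →ₗ[ℝ] ℝ) : ∃ a : ι → ℝ, ∀ x, φ x = dotProduct a x := by
  classical
  refine ⟨fun i => φ (Pi.single i 1), fun x => ?_⟩
  rw [LinearMap.pi_apply_eq_sum_univ φ x]
  simp only [dotProduct, smul_eq_mul]
  refine Finset.sum_congr rfl fun i _ => ?_
  rw [mul_comm]
  congr 2
  ext j
  simp [Pi.single_apply, eq_comm]

theorem dotProduct_le_of_mem_convexHull {V : Set (ι → ℝ)} {a : ι → ℝ} {b : ℝ}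
    (h : ∀ v ∈ V, dotProduct a v ≤ b) {x : ι → ℝ} (hx : x ∈ convexHull ℝ V) :
    dotProduct a x ≤ b :=
  convexHull_min (t := {x | dotProduct a x ≤ b}) h
    (convex_halfSpace_le (dotProductBilin ℝ ℝ a).isLinear b) hx

/-- A nonempty face of codimension at least two is contained in a larger face that still avoids
a given point. -/
theorem exists_larger_face {V : Set (ι → ℝ)} (hV : V.Finite) {F : Set (ι → ℝ)}
    (hF : IsFace (convexHull ℝ V) F) (hne : F.Nonempty) {y : ι → ℝ} (hy : y ∈ convexHull ℝ V)
    (hyF : y ∉ F) (hdim : affDim F + 1 ≠ affDim (convexHull ℝ V)) :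
    ∃ F', IsFace (convexHull ℝ V) F' ∧ F ⊆ F' ∧ y ∉ F' ∧ affDim F < affDim F' := by
  obtain ⟨a, b, hval, rfl⟩ := hF
  set K := convexHull ℝ V with hKdef
  set F := {x | x ∈ K ∧ dotProduct a x = b} with hFdef
  obtain ⟨x, hx⟩ := id hne
  have hFK : F ⊆ K := fun _ h => h.1
  have hyb : dotProduct a y < b := lt_of_le_of_ne (hval y hy) fun h => hyF ⟨hy, h⟩
  have hlt : affDim F < affDim K :=
    affDim_lt_of_dotProduct_ne hFK hne (fun _ h => h.2) hy hyb.ne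
  -- Codimension at least two makes `W` too small to contain all directions of the polytope, so some
  -- functional `c` kills `W` but not every vertex direction.
  set W := vectorSpan ℝ F ⊔ Submodule.span ℝ {y - x} with hW
  have hfW : Module.finrank ℝ W ≤ affDim F + 1 := by
    refine (Submodule.finrank_add_le_finrank_add_finrank _ _).trans ?_
    have := finrank_span_le_card (R := ℝ) ({y - x} : Set (ι → ℝ))
    simp only [Set.toFinset_singleton, Finset.card_singleton] at this
    exact Nat.add_le_add_left this _
  obtain ⟨z, hzV, hzW⟩ : ∃ z ∈ V, z - x ∉ W := by
    by_contra! hcon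
    have hsub : K ⊆ {z | z - x ∈ W} := by
      refine convexHull_min hcon ?_
      have : {z | z - x ∈ W} = (fun z => z + -x) ⁻¹' (W : Set (ι → ℝ)) := by
        ext; simp [sub_eq_add_neg]
      rw [this]
      exact W.convex.translate_preimage_left (-x)
    have hle : vectorSpan ℝ K ≤ W := by
      rw [vectorSpan_def, Submodule.span_le]
      rintro _ ⟨u, hu, v, hv, rfl⟩
      have := W.sub_mem (hsub hu) (hsub hv)
      simpa using this
    have := Submodule.finrank_mono hle
    have h2 : affDim K ≤ affDim F + 1 := this.trans hfW
    omega
  obtain ⟨φ, hφz, hφW⟩ := Submodule.exists_le_ker_of_notMem hzW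
  obtain ⟨c, hc⟩ : ∃ c : ι → ℝ, (∀ w ∈ W, dotProduct c w = 0) ∧ 0 < dotProduct c (z - x) := by
    obtain ⟨c, hc⟩ := exists_dotProduct_eq φ
    have h0 : ∀ w ∈ W, dotProduct c w = 0 := fun w hw => by
      rw [← hc]; exact hφW hw
    rw [hc] at hφz
    rcases lt_or_gt_of_ne hφz with h | h
    · exact ⟨-c, fun w hw => by simp [h0 w hw], by simpa using h⟩
    · exact ⟨c, h0, h⟩
  obtain ⟨hcW, hcz⟩ := hc
  have hcF : ∀ u ∈ F, dotProduct c (u - x) = 0 := fun u hu =>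
    hcW _ (Submodule.mem_sup_left (vsub_mem_vectorSpan ℝ hu hx))
  have hcy : dotProduct c (y - x) = 0 :=
    hcW _ (Submodule.mem_sup_right (Submodule.mem_span_singleton_self _))
  -- Ratio test: tilt `a` towards `c` until the first new vertex becomes tight. Since `c` vanishes
  -- on `y - x`, the slack at `y` does not change.
  obtain ⟨v, ⟨hvV, hvc⟩, hvmin⟩ := Set.exists_min_image {v | v ∈ V ∧ 0 < dotProduct c (v - x)}
    (fun v => (b - dotProduct a v) / dotProduct c (v - x)) (hV.subset fun _ h => h.1)
    ⟨z, hzV, hcz⟩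
  set T := (b - dotProduct a v) / dotProduct c (v - x) with hT
  have hT0 : 0 ≤ T := div_nonneg (sub_nonneg.2 (hval v (subset_convexHull ℝ V hvV))) hvc.le
  have hdot : ∀ u, dotProduct (a + T • c) u =
      dotProduct a u + T * dotProduct c (u - x) + T * dotProduct c x := fun u => by
    simp only [add_dotProduct, smul_dotProduct, smul_eq_mul, dotProduct_sub]; ring
  have hvF' : dotProduct (a + T • c) v = b + T * dotProduct c x := by
    rw [hdot, hT, div_mul_cancel₀ _ hvc.ne']; ring
  have hvb : dotProduct a v ≠ b := fun h =>
    hvc.ne' (hcF v ⟨subset_convexHull ℝ V hvV, h⟩)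
  refine ⟨{u | u ∈ K ∧ dotProduct (a + T • c) u = b + T * dotProduct c x}, ⟨_, _, ?_, rfl⟩, ?_,
    ?_, ?_⟩
  · refine fun u hu => dotProduct_le_of_mem_convexHull (fun w hw => ?_) hu
    rw [hdot]
    have hwb := hval w (subset_convexHull ℝ V hw)
    rcases le_or_gt (dotProduct c (w - x)) 0 with h | h
    · have := mul_nonpos_of_nonneg_of_nonpos hT0 h
      linarith
    · have := hvmin w ⟨hw, h⟩
      rw [le_div_iff₀ h] at this
      linarith
  · intro u hu
    refine ⟨hu.1, ?_⟩
    rw [hdot, hcF u hu, hu.2]; ring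
  · rintro ⟨-, h⟩
    rw [hdot, hcy] at h
    linarith
  · refine affDim_lt_of_dotProduct_ne ?_ hne (fun _ h => h.2)
      ⟨subset_convexHull ℝ V hvV, hvF'⟩ hvb
    intro u hu
    refine ⟨hu.1, ?_⟩
    rw [hdot, hcF u hu, hu.2]; ring

/-- A nonempty face of a polytope and a point outside of it are separated by a facet. -/
theorem exists_facet_separating {K : Set (ι → ℝ)} (hK : IsPolytope K) {G : Set (ι → ℝ)}
    (hG : IsFace K G) (hne : G.Nonempty) {y : ι → ℝ} (hy : y ∈ K) (hyG : y ∉ G) :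
    ∃ F, IsFacet K F ∧ G ⊆ F ∧ y ∉ F := by
  obtain ⟨V, hV, rfl⟩ := hK.exists_finite_convexHull
  induction hk : affDim (convexHull ℝ V) - affDim G using Nat.strong_induction_on
    generalizing G with
  | _ k ih =>
    by_cases hdim : affDim G + 1 = affDim (convexHull ℝ V)
    · exact ⟨G, ⟨hG, hne, hdim⟩, subset_rfl, hyG⟩
    · obtain ⟨F, hF, hGF, hyF, hlt⟩ := exists_larger_face hV hG hne hy hyG hdim
      have hle : affDim F ≤ affDim (convexHull ℝ V) := by
        obtain ⟨a, b, -, rfl⟩ := hF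
        exact affDim_mono fun _ h => h.1
      obtain ⟨F', h1, h2, h3⟩ := ih (affDim (convexHull ℝ V) - affDim F) (by omega)
        (G := F) (hG := hF) (hne := hne.mono hGF) (hyG := hyF) rfl
      exact ⟨F', h1, hGF.trans h2, h3⟩

end Faces

/-! ### Covering disjoint pairs by rectangles -/

section Rectangles

open Classical in
/-- The number of disjoint pairs of subsets of `S` in the rectangle `p × q`. -/
noncomputable def disjointPairs {α : Type*} (S : Finset α) (p q : Finset α → Prop) : ℕ :=
  ∑ a ∈ S.powerset, ∑ b ∈ S.powerset, if Disjoint a b ∧ p a ∧ q b then 1 else 0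

/-- Each element independently lies in `a`, in `b`, or in neither. -/
theorem sum_disjoint_powerset {α : Type*} [DecidableEq α] (S : Finset α) :
    ∑ a ∈ S.powerset, ∑ b ∈ S.powerset, (if Disjoint a b then 1 else 0) = 3 ^ S.card := by
  induction S using Finset.induction_on with
  | empty => simp
  | insert x S hx ih =>
    rw [Finset.card_insert_of_notMem hx, pow_succ, ← ih]
    simp only [Finset.sum_powerset_insert hx]
    rw [← Finset.sum_add_distrib, Finset.sum_mul]
    refine Finset.sum_congr rfl fun a ha => ?_
    rw [← Finset.sum_add_distrib, ← Finset.sum_add_distrib, ← Finset.sum_add_distrib,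
      Finset.sum_mul]
    refine Finset.sum_congr rfl fun b hb => ?_
    have hxa : x ∉ a := fun h => hx (Finset.mem_powerset.1 ha h)
    have hxb : x ∉ b := fun h => hx (Finset.mem_powerset.1 hb h)
    have h1 : Disjoint a (insert x b) ↔ Disjoint a b := by
      simp [Finset.disjoint_insert_right, hxa]
    have h2 : Disjoint (insert x a) b ↔ Disjoint a b := by
      simp [Finset.disjoint_insert_left, hxb]
    have h3 : ¬ Disjoint (insert x a) (insert x b) := by simp
    simp only [h1, h2, h3, if_false]
    split_ifs <;> rfl

open Classical in
theorem ite_add_ite_le {A A' B B' : Prop} (h : ¬ (A' ∧ B')) :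
    (if A ∧ B then 1 else 0) + (if A ∧ B' then 1 else 0) + (if A' ∧ B then 1 else 0) ≤
      (if (A ∨ A') ∧ B then 1 else 0) + (if A ∧ (B ∨ B') then 1 else 0) := by
  by_cases hA : A <;> by_cases hB : B <;> by_cases hA' : A' <;> by_cases hB' : B' <;>
    simp_all

/-- A rectangle containing no pair of sets that meet in exactly one element contains at most
`2 ^ |S|` disjoint pairs. -/
theorem disjointPairs_le {α : Type*} [DecidableEq α] (S : Finset α) (p q : Finset α → Prop)
    (h : ∀ a ⊆ S, ∀ b ⊆ S, p a → q b → (a ∩ b).card ≠ 1) :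
    disjointPairs S p q ≤ 2 ^ S.card := by
  classical
  induction S using Finset.induction_on generalizing p q with
  | empty =>
    simp only [disjointPairs, Finset.powerset_empty, Finset.sum_singleton]
    split_ifs <;> simp
  | insert x S hx ih =>
    have hmem : ∀ a ⊆ S, x ∉ a := fun a ha h => hx (ha h)
    have hsub : ∀ a ⊆ S, insert x a ⊆ insert x S := fun a ha => Finset.insert_subset_insert x ha
    have hsub' : ∀ a ⊆ S, a ⊆ insert x S := fun a ha => ha.trans (Finset.subset_insert x S)
    -- Two rectangles on `S` absorb the count: one forgets whether `x` lies in the first set, the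
    -- other whether it lies in the second.
    have e1 := ih (fun a => p a ∨ p (insert x a)) q (by
      rintro a ha b hb (hp | hp) hq
      · exact h a (hsub' a ha) b (hsub' b hb) hp hq
      · have := h _ (hsub a ha) b (hsub' b hb) hp hq
        rwa [Finset.insert_inter_of_notMem (hmem b hb)] at this)
    have e2 := ih p (fun b => q b ∨ q (insert x b)) (by
      rintro a ha b hb hp (hq | hq)
      · exact h a (hsub' a ha) b (hsub' b hb) hp hq
      · have := h a (hsub' a ha) _ (hsub b hb) hp hq
        rwa [Finset.inter_insert_of_notMem (hmem a ha)] at this)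
    rw [Finset.card_insert_of_notMem hx, pow_succ, mul_two]
    refine le_trans ?_ (add_le_add e1 e2)
    unfold disjointPairs
    simp only [Finset.sum_powerset_insert hx]
    rw [← Finset.sum_add_distrib, ← Finset.sum_add_distrib]
    refine Finset.sum_le_sum fun a ha => ?_
    rw [← Finset.sum_add_distrib, ← Finset.sum_add_distrib, ← Finset.sum_add_distrib,
      ← Finset.sum_add_distrib]
    refine Finset.sum_le_sum fun b hb => ?_
    rw [Finset.mem_powerset] at ha hb
    have h1 : Disjoint a (insert x b) ↔ Disjoint a b := by
      simp [Finset.disjoint_insert_right, hmem a ha]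
    have h2 : Disjoint (insert x a) b ↔ Disjoint a b := by
      simp [Finset.disjoint_insert_left, hmem b hb]
    have h3 : ¬ Disjoint (insert x a) (insert x b) := by simp
    have h4 : Disjoint a b → ¬ (p (insert x a) ∧ q (insert x b)) := by
      rintro hd ⟨hp, hq⟩
      refine h _ (hsub a ha) _ (hsub b hb) hp hq ?_
      rw [← Finset.insert_inter_distrib, Finset.disjoint_iff_inter_eq_empty.1 hd]
      simp
    simp only [h1, h2, h3, false_and, if_false]
    by_cases hd : Disjoint a b
    · simp only [hd, true_and]
      have := ite_add_ite_le (h4 hd) (A := p a) (B := q b)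
      omega
    · simp [hd]

/-- Any cover of the disjoint pairs by rectangles without pairs meeting in exactly one element
has at least `(3 / 2) ^ |S|` members. -/
theorem three_pow_le_of_rectangle_cover {α κ : Type*} [DecidableEq α] (S : Finset α)
    (I : Finset κ) (p q : κ → Finset α → Prop)
    (hcover : ∀ a ⊆ S, ∀ b ⊆ S, Disjoint a b → ∃ k ∈ I, p k a ∧ q k b)
    (h : ∀ k ∈ I, ∀ a ⊆ S, ∀ b ⊆ S, p k a → q k b → (a ∩ b).card ≠ 1) :
    3 ^ S.card ≤ I.card * 2 ^ S.card := by
  classical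
  calc 3 ^ S.card
      = ∑ a ∈ S.powerset, ∑ b ∈ S.powerset, (if Disjoint a b then 1 else 0) :=
        (sum_disjoint_powerset S).symm
    _ ≤ ∑ a ∈ S.powerset, ∑ b ∈ S.powerset, ∑ k ∈ I,
          (if Disjoint a b ∧ p k a ∧ q k b then 1 else 0) := by
        refine Finset.sum_le_sum fun a ha => Finset.sum_le_sum fun b hb => ?_
        split_ifs with hd
        · obtain ⟨k, hk, hp, hq⟩ :=
            hcover a (Finset.mem_powerset.1 ha) b (Finset.mem_powerset.1 hb) hd
          refine le_trans ?_ (Finset.single_le_sum (fun _ _ => Nat.zero_le _) hk)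
          simp [hd, hp, hq]
        · exact Nat.zero_le _
    _ = ∑ k ∈ I, disjointPairs S (p k) (q k) := by
        simp only [disjointPairs]
        rw [Finset.sum_comm (s := I)]
        refine Finset.sum_congr rfl fun a _ => ?_
        rw [Finset.sum_comm]
        congr!
    _ ≤ ∑ k ∈ I, 2 ^ S.card := Finset.sum_le_sum fun k hk => disjointPairs_le S _ _ (h k hk)
    _ = I.card * 2 ^ S.card := by simp

end Rectangles

/-! ### The slack of the inequalities at the vertices -/

section Slack

variable {n : ℕ}

/-- The coefficient vector of the inequality with parameter `β = 2`. -/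
def qap2Coeff (P Q : Finset (Fin n)) : QAPIndex n → ℝ := fun p =>
  if p.1 ∈ P ×ˢ Q ∧ p.2 ∈ P ×ˢ Q then
    (if p.1 = p.2 then 1 else 0) - (if p.1.1 < p.2.1 then 1 else 0)
  else 0

theorem dotProduct_qap2Coeff (P Q : Finset (Fin n)) (Y : QAPIndex n → ℝ) :
    dotProduct (qap2Coeff P Q) Y = (∑ p ∈ P ×ˢ Q, Y (p, p))
      - ∑ p ∈ P ×ˢ Q, ∑ q ∈ P ×ˢ Q, if p.1 < q.1 then Y (p, q) else 0 := by
  have h : dotProduct (qap2Coeff P Q) Y = ∑ p ∈ P ×ˢ Q, ∑ q ∈ P ×ˢ Q,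
      ((if p = q then Y (p, q) else 0) - (if p.1 < q.1 then Y (p, q) else 0)) := by
    rw [← Finset.sum_product' (s := P ×ˢ Q) (t := P ×ˢ Q) (f := fun p q =>
      ((if p = q then Y (p, q) else 0) - (if p.1 < q.1 then Y (p, q) else 0)))]
    rw [dotProduct, ← Finset.sum_subset (Finset.subset_univ ((P ×ˢ Q) ×ˢ (P ×ˢ Q)))]
    · refine Finset.sum_congr rfl fun p hp => ?_
      rw [Finset.mem_product] at hp
      simp only [qap2Coeff, hp, and_self, if_true]
      split_ifs <;> simp
    · intro p _ hp
      rw [Finset.mem_product] at hp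
      rw [qap2Coeff, if_neg hp, zero_mul]
  rw [h, ← Finset.sum_sub_distrib]
  refine Finset.sum_congr rfl fun p hp => ?_
  rw [Finset.sum_sub_distrib, Finset.sum_ite_eq, if_pos hp]

theorem qap2Inequality_two_iff (P Q : Finset (Fin n)) (Y : QAPIndex n → ℝ) :
    QAP2Inequality P Q 2 Y ↔ dotProduct (qap2Coeff P Q) Y ≤ 1 := by
  rw [dotProduct_qap2Coeff, QAP2Inequality]
  norm_num

/-- The quadratic sum counts pairs of elements of `P` sent into `Q`, so it vanishes when there is at
most one such element. -/
theorem dotProduct_qapVertex (P Q : Finset (Fin n)) (σ : Equiv.Perm (Fin n))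
    (h : (P.filter fun i => σ i ∈ Q).card ≤ 1) :
    dotProduct (qap2Coeff P Q) (qapVertex σ) = (P.filter fun i => σ i ∈ Q).card := by
  rw [dotProduct_qap2Coeff]
  have h1 : ∑ p ∈ P ×ˢ Q, qapVertex σ (p, p) = (P.filter fun i => σ i ∈ Q).card := by
    rw [Finset.sum_product, Finset.card_filter, Nat.cast_sum]
    refine Finset.sum_congr rfl fun i _ => ?_
    simp [qapVertex, permEntry]
  have h2 : ∑ p ∈ P ×ˢ Q, ∑ q ∈ P ×ˢ Q, (if p.1 < q.1 then qapVertex σ (p, q) else 0) = 0 := by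
    refine Finset.sum_eq_zero fun p hp => Finset.sum_eq_zero fun q hq => ?_
    rw [Finset.mem_product] at hp hq
    split_ifs with hlt
    · by_cases hpσ : σ p.1 = p.2
      · by_cases hqσ : σ q.1 = q.2
        · refine absurd (Finset.card_le_one.1 h p.1 ?_ q.1 ?_) hlt.ne
          · simp [hp.1, hpσ, hp.2]
          · simp [hq.1, hqσ, hq.2]
        · simp [qapVertex, permEntry, hqσ]
      · simp [qapVertex, permEntry, hpσ]
    · rfl
  rw [h1, h2, sub_zero]

/-- The map fixing `i` and `i + M` for `i ∈ B` and exchanging them for the other `i < M`. -/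
def swapFun (M : ℕ) (B : Finset ℕ) (i : ℕ) : ℕ :=
  if i < M then (if i ∈ B then i else i + M)
  else if i < 2 * M then (if i - M ∈ B then i else i - M) else i

theorem swapFun_lt {M : ℕ} (hn : 2 * M ≤ n) (B : Finset ℕ) {i : ℕ} (hi : i < n) :
    swapFun M B i < n := by
  unfold swapFun; split_ifs <;> omega

theorem swapFun_swapFun (M : ℕ) (B : Finset ℕ) (i : ℕ) : swapFun M B (swapFun M B i) = i := by
  unfold swapFun
  by_cases h1 : i < M
  · by_cases h2 : i ∈ B
    · simp [h1, h2]
    · have : i + M < 2 * M := by omega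
      simp [h1, h2, this]
  · by_cases h2 : i < 2 * M
    · by_cases h3 : i - M ∈ B
      · simp [h1, h2, h3]
      · have h4 : i - M < M := by omega
        have h5 : i - M + M = i := by omega
        simp [h1, h2, h3, h4, h5]
    · simp [h1, h2]

/-- The permutation fixing `i` and `i + M` for `i ∈ B` and exchanging them for the other `i < M`. -/
def swapPerm {M : ℕ} (hn : 2 * M ≤ n) (B : Finset ℕ) : Equiv.Perm (Fin n) :=
  Function.Involutive.toPerm (fun i => ⟨swapFun M B i, swapFun_lt hn B i.2⟩)
    fun i => Fin.ext (swapFun_swapFun M B i)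

/-- A set of natural numbers as a set of elements of `Fin n`. -/
def toFin (n : ℕ) (A : Finset ℕ) : Finset (Fin n) := Finset.univ.filter fun i => (i : ℕ) ∈ A

theorem card_toFin {M : ℕ} (hn : M ≤ n) {A : Finset ℕ} (hA : A ⊆ Finset.range M) :
    (toFin n A).card = A.card := by
  refine Finset.card_bij (fun i _ => (i : ℕ)) (fun i hi => by simpa [toFin] using hi)
    (fun i _ j _ h => Fin.ext h) fun a ha => ?_
  have := Finset.mem_range.1 (hA ha)
  exact ⟨⟨a, by omega⟩, by simpa [toFin] using ha, rfl⟩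

theorem card_filter_swapPerm {M : ℕ} (hn : 2 * M ≤ n) {A : Finset ℕ} (hA : A ⊆ Finset.range M)
    (B : Finset ℕ) :
    ((toFin n A).filter fun i => swapPerm hn B i ∈ toFin n A).card = (A ∩ B).card := by
  rw [← card_toFin (n := n) (M := M) (by omega) (Finset.inter_subset_left.trans hA)]
  congr 1
  ext i
  simp only [toFin, Finset.mem_filter, Finset.mem_univ, true_and, Finset.mem_inter]
  refine and_congr_right fun hi => ?_
  have hiM := Finset.mem_range.1 (hA hi)
  change swapFun M B i ∈ A ↔ _
  by_cases hB : (i : ℕ) ∈ B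
  · simp [swapFun, hiM, hB, hi]
  · simp only [swapFun, hiM, hB, if_true, if_false, iff_false]
    intro h
    have := Finset.mem_range.1 (hA h)
    omega

end Slack

/-! ### The lower bound -/

theorem three_pow_le_card_facets {n m : ℕ} (hn : 2 * (m + 3) + 1 ≤ n)
    {R : Set (QAPIndex n → ℝ)} (hQ : qapPolytope n ⊆ R) (hR : QAP2Valid R) {r : ℕ}
    {K : Set (QAPIndex n ⊕ Fin r → ℝ)} (hK : IsExtension R r K)
    (hfin : {F | IsFacet K F}.Finite) :
    3 ^ m ≤ hfin.toFinset.card * 2 ^ m := by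
  obtain ⟨hpoly, hproj⟩ := hK
  have hn' : 2 * (m + 3) ≤ n := by omega
  have hlift : ∀ B : Finset ℕ, ∃ y : Fin r → ℝ, Sum.elim (qapVertex (swapPerm hn' B)) y ∈ K := by
    intro B
    have : qapVertex (swapPerm hn' B) ∈ R := hQ (subset_convexHull ℝ _ ⟨_, rfl⟩)
    rw [hproj] at this
    exact this
  choose y hy using hlift
  -- Three extra elements give `|P| ≥ β + 1 = 3`; lying outside `range m`, they leave intersections
  -- with `b` unchanged.
  set pad : Finset ℕ → Finset ℕ := fun a => a ∪ {m, m + 1, m + 2} with hpad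
  set G : Finset ℕ → Set (QAPIndex n ⊕ Fin r → ℝ) := fun a =>
    {x | x ∈ K ∧ dotProduct
      (Sum.elim (qap2Coeff (toFin n (pad a)) (toFin n (pad a))) (0 : Fin r → ℝ)) x = 1} with hG
  have hpadM : ∀ a ⊆ Finset.range m, pad a ⊆ Finset.range (m + 3) := by
    intro a ha i hi
    simp only [hpad, Finset.mem_union, Finset.mem_insert, Finset.mem_singleton] at hi
    rw [Finset.mem_range]
    rcases hi with hi | hi
    · have := Finset.mem_range.1 (ha hi)
      omega
    · omega
  have hadm : ∀ a ⊆ Finset.range m, QAP2Admissible (toFin n (pad a)) (toFin n (pad a)) 2 := by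
    intro a ha
    have h1 : (toFin n (pad a)).card = (pad a).card :=
      card_toFin (M := m + 3) (by omega) (hpadM a ha)
    have h2 : (pad a).card ≤ m + 3 := by
      simpa using Finset.card_le_card (hpadM a ha)
    have h3 : 3 ≤ (pad a).card := by
      have : ({m, m + 1, m + 2} : Finset ℕ).card = 3 := by
        rw [Finset.card_eq_three]
        exact ⟨m, m + 1, m + 2, by omega, by omega, by omega, rfl⟩
      rw [← this]
      exact Finset.card_le_card Finset.subset_union_right
    -- The binding condition is `2 * (m + 3) + 3 ≤ n + 2`, which is `hn`.
    unfold QAP2Admissible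
    omega
  have hdot : ∀ a ⊆ Finset.range m, ∀ B : Finset ℕ, (pad a ∩ B).card ≤ 1 →
      dotProduct (Sum.elim (qap2Coeff (toFin n (pad a)) (toFin n (pad a))) (0 : Fin r → ℝ))
        (Sum.elim (qapVertex (swapPerm hn' B)) (y B)) = (pad a ∩ B).card := by
    intro a ha B hB
    have hcard := card_filter_swapPerm hn' (hpadM a ha) B
    rw [sumElim_dotProduct_sumElim, zero_dotProduct, add_zero,
      dotProduct_qapVertex _ _ _ (hcard.trans_le hB), hcard]
  have hface : ∀ a ⊆ Finset.range m, IsFace K (G a) := by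
    intro a ha
    refine ⟨_, _, fun x hx => ?_, rfl⟩
    obtain ⟨u, v, rfl⟩ : ∃ u v, x = Sum.elim u v := ⟨_, _, (Sum.elim_comp_inl_inr x).symm⟩
    rw [sumElim_dotProduct_sumElim, zero_dotProduct, add_zero, ← qap2Inequality_two_iff]
    refine hR _ _ _ (hadm a ha) u ?_
    rw [hproj]
    exact ⟨v, hx⟩
  have hGne : ∀ a ⊆ Finset.range m, (G a).Nonempty := by
    intro a ha
    -- The padding element `m` gives a vertex tight for every `a`, even the empty set.
    have h1 : pad a ∩ {m} = {m} := by
      rw [Finset.inter_eq_right]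
      simp [hpad]
    refine ⟨Sum.elim (qapVertex (swapPerm hn' {m})) (y {m}), hy _, ?_⟩
    rw [hdot a ha _ (by rw [h1]; simp), h1]
    simp
  have hpadinter : ∀ a, ∀ b ⊆ Finset.range m, pad a ∩ b = a ∩ b := by
    intro a b hb
    rw [hpad, Finset.union_inter_distrib_right]
    refine Finset.union_eq_left.2 fun i hi => ?_
    simp only [Finset.mem_inter, Finset.mem_insert, Finset.mem_singleton] at hi
    have := Finset.mem_range.1 (hb hi.2)
    omega
  have key := three_pow_le_of_rectangle_cover (Finset.range m) hfin.toFinset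
    (fun F a => G a ⊆ F) (fun F b => Sum.elim (qapVertex (swapPerm hn' b)) (y b) ∉ F) ?_ ?_
  · simpa using key
  · intro a ha b hb hd
    have h0 : (pad a ∩ b).card = 0 := by
      rw [hpadinter a b hb, Finset.disjoint_iff_inter_eq_empty.1 hd, Finset.card_empty]
    obtain ⟨F, hF, h1, h2⟩ := exists_facet_separating hpoly (hface a ha) (hGne a ha) (hy b) (by
      rintro ⟨-, h⟩
      rw [hdot a ha b (by omega), h0] at h
      simp at h)
    exact ⟨F, by simpa using hF, h1, h2⟩
  · intro F _ a ha b hb h1 h2 hcard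
    refine h2 (h1 ⟨hy b, ?_⟩)
    have h0 : (pad a ∩ b).card = 1 := by rw [hpadinter a b hb, hcard]
    rw [hdot a ha b h0.le, h0, Nat.cast_one]

theorem two_rpow_le_of_three_pow_le {n N : ℕ} (hn : 16 ≤ n)
    (h : 3 ^ ((n - 7) / 2) ≤ N * 2 ^ ((n - 7) / 2)) : (2 : ℝ) ^ (1 / 8 * (n : ℝ)) ≤ N := by
  set m := (n - 7) / 2 with hm
  have h1 : (3 / 2 : ℝ) ^ m ≤ N := by
    rw [div_pow, div_le_iff₀ (by positivity)]
    exact_mod_cast h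
  -- This is where `16 ≤ n` enters; with `√2 ≤ 3 / 2` it gives the exponent `n / 8`.
  have h2 : (n : ℝ) ≤ 4 * m := by
    have : n ≤ 4 * m := by omega
    exact_mod_cast this
  refine le_trans ?_ h1
  calc (2 : ℝ) ^ (1 / 8 * (n : ℝ)) ≤ (2 : ℝ) ^ (1 / 2 * (m : ℝ)) :=
        Real.rpow_le_rpow_of_exponent_le (by norm_num) (by linarith)
    _ = ((2 : ℝ) ^ (1 / 2 : ℝ)) ^ m := by rw [Real.rpow_mul (by norm_num), Real.rpow_natCast]
    _ ≤ (3 / 2 : ℝ) ^ m := by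
        refine pow_le_pow_left₀ (by positivity) ?_ m
        rw [← Real.sqrt_eq_rpow, Real.sqrt_le_left (by norm_num)]
        norm_num

end QAPExt

theorem mainTheorem3 :
    ∃ c : ℝ, 0 < c ∧ ∃ n₀ : ℕ, ∀ n : ℕ, n₀ ≤ n →
      ∀ R : Set (QAPExt.QAPIndex n → ℝ),
        QAPExt.IsPolytope R → QAPExt.qapPolytope n ⊆ R → QAPExt.QAP2Valid R →
          ENNReal.ofReal ((2 : ℝ) ^ (c * (n : ℝ))) ≤
            ((QAPExt.extensionComplexity R : ℕ∞) : ENNReal) := by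
  refine ⟨1 / 8, by norm_num, 16, fun n hn R _ hQ hR => ?_⟩
  have hbound : ((⌈(2 : ℝ) ^ (1 / 8 * (n : ℝ))⌉₊ : ℕ) : ℕ∞) ≤ QAPExt.extensionComplexity R := by
    refine le_sInf ?_
    rintro _ ⟨r, K, hK, rfl⟩
    by_cases hfin : {F | QAPExt.IsFacet K F}.Finite
    · rw [QAPExt.size, hfin.encard_eq_coe_toFinset_card, Nat.cast_le, Nat.ceil_le]
      exact QAPExt.two_rpow_le_of_three_pow_le hn
        (QAPExt.three_pow_le_card_facets (by omega) hQ hR hK hfin)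
    · rw [QAPExt.size, Set.Infinite.encard_eq hfin]
      exact le_top
  calc ENNReal.ofReal ((2 : ℝ) ^ (1 / 8 * (n : ℝ)))
      ≤ ENNReal.ofReal (⌈(2 : ℝ) ^ (1 / 8 * (n : ℝ))⌉₊ : ℝ) :=
        ENNReal.ofReal_le_ofReal (Nat.le_ceil _)
    _ = (((⌈(2 : ℝ) ^ (1 / 8 * (n : ℝ))⌉₊ : ℕ) : ℕ∞) : ENNReal) := by simp
    _ ≤ _ := ENat.toENNReal_le.2 hbound
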